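/- **Route nimbers for two-color flag coloring.** *Flag coloring* is the impartial game played on a finite simple graph with colored vertices in which a move consists of choosing a vertex $x$ of color $c$ and a color $c'\ne c$ that occurs on a neighbor of $x$, and recoloring with $c'$ all vertices of the connected color-$c$ component containing $x$. The value $\ast n$ (written $n$ below) of a position is defined recursively: $n$ is the least non-negative integer that is not the value of an option (so $0$ if there are no options). Let $G$ be the simple graph made of two vertices $u,v$ joined by finitely many internally disjoint paths of prescribed lengths; a path of length $0$ means that $u$ and $v$ are merged into one vertex, a path of length $1$ means that $u$ and $v$ are adjacent, and parallel edges are replaced by a single edge. We write $P_{0^a2^i4^j6^k}$ for the graph with $a,i,j,k$ paths of lengths $0,2,4,6$ and $P_{1^a3^i5^j}$ for the graph with $a,i,j$ paths of lengths $1,3,5$; an exponent $m+$ stands for any integer $\ge m$. Let $i,j\ge 0$. For every proper coloring of the graph with two colors, the value of the position is the entry in the row of $i$ and the column of $j$ of the corresponding table below, in which both the rows and the columns are labelled, in this order, $0,\ 1,\ 2,\ 3,\ 2k'+4,\ 2k'+5$ ($k'\ge 0$; so every even number $\ge 4$ has the fifth label and every odd number $\ge 5$ the sixth). 1. $P_{0^{1+}2^i4^j6^1}$: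 $\begin{pmatrix}1&1&1&1&1&1\\2&0&3&0&3&0\\1&1&1&1&1&1\\2&0&3&0&3&0\\1&1&1&1&1&1\\2&0&3&0&3&0\end{pmatrix}$ 2. $P_{0^{1+}2^i4^j6^2}$: $\begin{pmatrix}2&0&2&0&2&0\\1&4&1&4&1&4\\2&0&2&0&2&0\\1&4&1&4&1&4\\2&0&2&0&2&0\\1&4&1&4&1&4\end{pmatrix}$ 3. $P_{0^{1+}2^i4^j6^{3+}}$: $\begin{pmatrix}1&0&1&0&1&0\\2&3&2&3&2&3\\1&0&1&0&1&0\\2&3&2&3&2&3\\1&0&1&0&1&0\\2&3&2&3&2&3\end{pmatrix}$ 4. $P_{1^{1+}3^i5^j}$: $\begin{pmatrix}1&1&1&1&1&1\\0&0&0&0&0&0\\1&1&1&1&1&1\\0&0&0&0&0&0\\1&1&1&1&1&1\\0&0&0&0&0&0\end{pmatrix}$ 5. $P_{2^i4^j}$ ($u\ne v$): $\begin{pmatrix}0&1&0&0&0&0\\2&1&2&1&2&1\\0&1&0&1&0&1\\0&1&2&1&2&1\\0&1&0&1&0&1\\0&1&2&1&2&1\end{pmatrix}$ 6. $P_{2^i4^j6^1}$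 ($u\ne v$): $\begin{pmatrix}0&1&1&1&1&1\\0&3&0&3&0&3\\0&1&0&1&0&1\\0&3&0&3&0&3\\0&1&0&1&0&1\\0&3&0&3&0&3\end{pmatrix}$ 7. $P_{2^i4^j6^2}$ ($u\ne v$): $\begin{pmatrix}0&2&0&2&0&2\\0&1&0&1&0&1\\0&1&0&1&0&1\\0&1&0&1&0&1\\0&1&0&1&0&1\\0&1&0&1&0&1\end{pmatrix}$ 8. $P_{2^i4^j6^{3+}}$ ($u\ne v$): $\begin{pmatrix}0&1&0&1&0&1\\0&1&0&1&0&1\\0&1&0&1&0&1\\0&1&0&1&0&1\\0&1&0&1&0&1\\0&1&0&1&0&1\end{pmatrix}$ 9. $P_{3^i5^j}$ ($u\ne v$, not adjacent): $\begin{pmatrix}0&2&1&1&1&1\\0&0&0&0&0&0\\1&3&1&2&1&2\\2&0&0&0&0&0\\1&3&1&2&1&2\\2&0&0&0&0&0\end{pmatrix}$ (In items 5 and 9 the entry $i=j=0$ is the graph of two isolated vertices, with value $0$.) -/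

import Mathlib

/-! ### The game -/

/-- The minimum excluded value of a set of natural numbers (used for finite sets only). -/
noncomputable def mex (S : Set ℕ) : ℕ := sInf Sᶜ

/-- The connected component of `v` among the vertices with the color of `v`: the vertices which
can be reached from `v` along edges whose two ends have the same color. -/
def colorRegion {V α : Type*} (G : SimpleGraph V) (c : V → α) (v : V) : Set V :=
  {x | Relation.ReflTransGen (fun a b => G.Adj a b ∧ c a = c b) v x}

open Classical in
/-- The coloring obtained from `c` by giving color `γ` to the whole color region of `v`. -/
noncomputable def recolor {V α : Type*} (G : SimpleGraph V) (c : V → α) (v : V) (γ : α) : V → α :=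
  fun x => if x ∈ colorRegion G c v then γ else c x

/-- The moves of flag coloring on the graph `G`: choose a vertex `v` and a neighbor `w` of `v` with
a different color, and give the color of `w` to the whole color region of `v`. -/
def IsOption {V α : Type*} (G : SimpleGraph V) (c c' : V → α) : Prop :=
  ∃ v w, G.Adj v w ∧ c w ≠ c v ∧ c' = recolor G c v (c w)

/-- The (ordered) edges whose two ends have different colors. -/
def mixedEdges {V α : Type*} (G : SimpleGraph V) (c : V → α) : Set (V × V) :=
  {e | G.Adj e.1 e.2 ∧ c e.1 ≠ c e.2}

/-- Every move makes the number of two-colored edges smaller, so every play is finite. -/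
theorem IsOption.ncard_mixedEdges_lt {V α : Type*} [Finite V] {G : SimpleGraph V}
    {c c' : V → α} (h : IsOption G c c') :
    (mixedEdges G c').ncard < (mixedEdges G c).ncard := by
  obtain ⟨v, w, hvw, hne, rfl⟩ := h
  have hsame : ∀ x ∈ colorRegion G c v, c x = c v := by
    intro x hx
    induction hx with
    | refl => rfl
    | tail _ hab ih => exact hab.2.symm.trans ih
  have hv : v ∈ colorRegion G c v := Relation.ReflTransGen.refl
  have hw : w ∉ colorRegion G c v := fun hw => hne (hsame w hw)
  have hclosed : ∀ a b, G.Adj a b → c a = c b → a ∈ colorRegion G c v →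
      b ∈ colorRegion G c v := fun a b hab hc ha => Relation.ReflTransGen.tail ha ⟨hab, hc⟩
  refine Set.ncard_lt_ncard ⟨?_, ?_⟩ (Set.toFinite _)
  · rintro ⟨a, b⟩ ⟨hab, hc⟩
    refine ⟨hab, fun hcab => hc ?_⟩
    have hiff : a ∈ colorRegion G c v ↔ b ∈ colorRegion G c v :=
      ⟨hclosed a b hab hcab, hclosed b a hab.symm hcab.symm⟩
    simp only [recolor]
    by_cases ha : a ∈ colorRegion G c v
    · rw [if_pos ha, if_pos (hiff.1 ha)]
    · rw [if_neg ha, if_neg (fun hb => ha (hiff.2 hb))]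
      exact hcab
  · intro hsub
    have hmem : (v, w) ∈ mixedEdges G c := ⟨hvw, hne.symm⟩
    refine (hsub hmem).2 ?_
    simp only [recolor]
    rw [if_pos hv, if_neg hw]

/-- The value (nimber) of the position `c` of flag coloring on the finite graph `G`: the minimum
excluded value of the set of the values of its options. -/
noncomputable def grundyValue {V α : Type*} [Finite V] (G : SimpleGraph V) (c : V → α) : ℕ :=
  mex (Set.range fun c' : {c' : V → α // IsOption G c c'} => grundyValue G c'.1)
termination_by (mixedEdges G c).ncard
decreasing_by exact IsOption.ncard_mixedEdges_lt c'.2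

/-! ### Two vertices joined by internally disjoint paths -/

/-- The end vertices `u = false` and `v = true` of a family of paths of lengths `l p`. There is only
one of them, `u`, if some path has length `0`, since `u` and `v` are then merged. -/
abbrev Terminal {ι : Type*} (l : ι → ℕ) : Type :=
  {t : Bool // (∃ p, l p = 0) → t = false}

/-- The vertices of the graph: the end vertices, and for each path `p` the interior vertices at the
positions `0 < s < l p`. -/
abbrev RouteVertex {ι : Type*} (l : ι → ℕ) : Type _ :=
  Terminal l ⊕ (Σ p : ι, Set.Ioo 0 (l p))

/-- The end vertex `u`. -/
def routeU {ι : Type*} (l : ι → ℕ) : RouteVertex l := Sum.inl ⟨false, fun _ => rfl⟩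

open Classical in
/-- The end vertex `v`, which is equal to `u` if some path has length `0`. -/
noncomputable def routeV {ι : Type*} (l : ι → ℕ) : RouteVertex l :=
  if h : ∃ p, l p = 0 then routeU l else Sum.inl ⟨true, fun h' => absurd h' h⟩

/-- The vertex at position `s` of the path `p`, for `0 ≤ s ≤ l p`; position `0` is `u` and
position `l p` is `v`. -/
noncomputable def routePoint {ι : Type*} (l : ι → ℕ) (p : ι) (s : ℕ) : RouteVertex l :=
  if h : s ∈ Set.Ioo 0 (l p) then Sum.inr ⟨p, s, h⟩
  else if s = 0 then routeU l else routeV l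

/-- The simple graph made of two vertices `u`, `v` and internally disjoint paths from `u` to `v`,
one path of length `l p` for each `p`. -/
def routeGraph {ι : Type*} (l : ι → ℕ) : SimpleGraph (RouteVertex l) :=
  SimpleGraph.fromRel fun x y =>
    ∃ p s, s < l p ∧ x = routePoint l p s ∧ y = routePoint l p (s + 1)

/-- The number of paths of length `m`. -/
noncomputable def routeCount {ι : Type*} (l : ι → ℕ) (m : ℕ) : ℕ := Nat.card {p // l p = m}

/-- The family `0^a 2^i 4^j 6^k` of path lengths. -/
def IsEvenRoutes {ι : Type*} (l : ι → ℕ) (a i j k : ℕ) : Prop :=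
  (∀ p, l p = 0 ∨ l p = 2 ∨ l p = 4 ∨ l p = 6) ∧
    routeCount l 0 = a ∧ routeCount l 2 = i ∧ routeCount l 4 = j ∧ routeCount l 6 = k

/-- The family `1^a 3^i 5^j` of path lengths. -/
def IsOddRoutes {ι : Type*} (l : ι → ℕ) (a i j : ℕ) : Prop :=
  (∀ p, l p = 1 ∨ l p = 3 ∨ l p = 5) ∧
    routeCount l 1 = a ∧ routeCount l 3 = i ∧ routeCount l 5 = j

/-- If all lengths have the same parity, then the graph has a proper coloring with two colors. -/
theorem nonempty_coloring_routeGraph {ι : Type*} (l : ι → ℕ) (r : ℕ) (hl : ∀ p, l p % 2 = r % 2) :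
    Nonempty ((routeGraph l).Coloring Bool) := by
  classical
  let f : RouteVertex l → Bool :=
    Sum.elim (fun t => t.1 && decide (r % 2 = 1)) (fun x => decide (x.2.1 % 2 = 1))
  have hf : ∀ p s, s ≤ l p → f (routePoint l p s) = decide (s % 2 = 1) := by
    intro p s hs
    by_cases h : s ∈ Set.Ioo 0 (l p)
    · simp [routePoint, h, f]
    · by_cases h0 : s = 0
      · simp [routePoint, h0, f, routeU]
      · have hsl : s = l p := by
          simp only [Set.mem_Ioo, not_and, not_lt] at h
          omega
        by_cases hm : ∃ p, l p = 0
        · obtain ⟨q, hq⟩ := hm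
          have h1 := hl q
          have h2 := hl p
          have : ∃ p, l p = 0 := ⟨q, hq⟩
          have h3 : ¬ s % 2 = 1 := by omega
          simp only [routePoint, h, h0, routeV, this, routeU, f]
          simp [h3]
        · have h2 := hl p
          have h3 : (s % 2 = 1) ↔ (r % 2 = 1) := by omega
          simp only [routePoint, h, h0, routeV, hm, f]
          simp [h3]
  have key : ∀ p s, s < l p → f (routePoint l p s) ≠ f (routePoint l p (s + 1)) := by
    intro p s hs
    rw [hf p s hs.le, hf p (s + 1) hs]
    intro h
    have := (decide_eq_decide.1 h)
    omega
  refine ⟨SimpleGraph.Coloring.mk f ?_⟩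
  intro x y hxy
  rw [routeGraph, SimpleGraph.fromRel_adj] at hxy
  obtain ⟨_, ⟨p, s, hs, rfl, rfl⟩ | ⟨p, s, hs, rfl, rfl⟩⟩ := hxy
  · exact key p s hs
  · exact (key p s hs).symm

/-! ### The tables -/

/-- Rows and columns of the tables have the labels `0`, `1`, `2`, `3`, `2k + 4`, `2k + 5`. -/
def tableIndex (n : ℕ) : Fin 6 :=
  if n = 0 then 0 else if n = 1 then 1 else if n = 2 then 2 else if n = 3 then 3
  else if Even n then 4 else 5

/-- The entry of a table for the counts `i` (row) and `j` (column). -/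
def tableEntry (A : Matrix (Fin 6) (Fin 6) ℕ) (i j : ℕ) : ℕ := A (tableIndex i) (tableIndex j)

/-- Values for `0^{1+} 2^i 4^j 6^1`. -/
def tableMerged1 : Matrix (Fin 6) (Fin 6) ℕ :=
  !![1, 1, 1, 1, 1, 1;
     2, 0, 3, 0, 3, 0;
     1, 1, 1, 1, 1, 1;
     2, 0, 3, 0, 3, 0;
     1, 1, 1, 1, 1, 1;
     2, 0, 3, 0, 3, 0]

/-- Values for `0^{1+} 2^i 4^j 6^2`. -/
def tableMerged2 : Matrix (Fin 6) (Fin 6) ℕ :=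
  !![2, 0, 2, 0, 2, 0;
     1, 4, 1, 4, 1, 4;
     2, 0, 2, 0, 2, 0;
     1, 4, 1, 4, 1, 4;
     2, 0, 2, 0, 2, 0;
     1, 4, 1, 4, 1, 4]

/-- Values for `0^{1+} 2^i 4^j 6^{3+}`. -/
def tableMerged3 : Matrix (Fin 6) (Fin 6) ℕ :=
  !![1, 0, 1, 0, 1, 0;
     2, 3, 2, 3, 2, 3;
     1, 0, 1, 0, 1, 0;
     2, 3, 2, 3, 2, 3;
     1, 0, 1, 0, 1, 0;
     2, 3, 2, 3, 2, 3]

/-- Values for `1^{1+} 3^i 5^j`. -/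
def tableAdjacent : Matrix (Fin 6) (Fin 6) ℕ :=
  !![1, 1, 1, 1, 1, 1;
     0, 0, 0, 0, 0, 0;
     1, 1, 1, 1, 1, 1;
     0, 0, 0, 0, 0, 0;
     1, 1, 1, 1, 1, 1;
     0, 0, 0, 0, 0, 0]

/-- Values for `2^i 4^j`. -/
def tableEven0 : Matrix (Fin 6) (Fin 6) ℕ :=
  !![0, 1, 0, 0, 0, 0;
     2, 1, 2, 1, 2, 1;
     0, 1, 0, 1, 0, 1;
     0, 1, 2, 1, 2, 1;
     0, 1, 0, 1, 0, 1;
     0, 1, 2, 1, 2, 1]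

/-- Values for `2^i 4^j 6^1`. -/
def tableEven1 : Matrix (Fin 6) (Fin 6) ℕ :=
  !![0, 1, 1, 1, 1, 1;
     0, 3, 0, 3, 0, 3;
     0, 1, 0, 1, 0, 1;
     0, 3, 0, 3, 0, 3;
     0, 1, 0, 1, 0, 1;
     0, 3, 0, 3, 0, 3]

/-- Values for `2^i 4^j 6^2`. -/
def tableEven2 : Matrix (Fin 6) (Fin 6) ℕ :=
  !![0, 2, 0, 2, 0, 2;
     0, 1, 0, 1, 0, 1;
     0, 1, 0, 1, 0, 1;
     0, 1, 0, 1, 0, 1;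
     0, 1, 0, 1, 0, 1;
     0, 1, 0, 1, 0, 1]

/-- Values for `2^i 4^j 6^{3+}`. -/
def tableEven3 : Matrix (Fin 6) (Fin 6) ℕ :=
  !![0, 1, 0, 1, 0, 1;
     0, 1, 0, 1, 0, 1;
     0, 1, 0, 1, 0, 1;
     0, 1, 0, 1, 0, 1;
     0, 1, 0, 1, 0, 1;
     0, 1, 0, 1, 0, 1]

/-- Values for `3^i 5^j`. -/
def tableOdd : Matrix (Fin 6) (Fin 6) ℕ :=
  !![0, 2, 1, 1, 1, 1;
     0, 0, 0, 0, 0, 0;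
     1, 3, 1, 2, 1, 2;
     2, 0, 0, 0, 0, 0;
     1, 3, 1, 2, 1, 2;
     2, 0, 0, 0, 0, 0]

/-! ### Minimum excluded values -/

/-! In a proper two-coloring every color region is a single vertex (`recolor_coloring`), and
recoloring it joins it to all of its neighbors. Contracting monochromatic connected sets does not
change the value (`IsContraction.grundyValue_comp`), so a move amounts to contracting a vertex
together with its neighbors. In a route graph whose lengths have a common parity, the result is
again such a graph with a proper coloring. An interior vertex takes two edges off its path. An end
vertex takes one edge off every path; if the ends are merged, it takes two edges off every
nontrivial path, one from each side. These are the moves of `RouteMove`;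
`exists_routeMove_of_isOption` and `RouteMove.exists_isOption` match them with the options of a
coloring.

Hence the value depends neither on the coloring nor on the number of paths of length 0 or 1, as long
as one exists: a `RouteState` suffices. The nine families of the theorem are not closed under moves;
adding `0^{1+} 2^i 4^j`, with its table `tableMerged0`, closes them.

It remains to check that each claimed value is the mex of the claimed values of the options. The
tables depend on the counts only through six labels, and the label of `n` determines that of `n +
1`, so this is a finite check (`RouteState.isMex_nimber`). Induction on the total length of the
paths then gives `HasState.grundyValue_eq`. -/

theorem mex_eq_of {S : Set ℕ} {n : ℕ} (hn : n ∉ S) (h : ∀ m < n, m ∈ S) : mex S = n := by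
  refine le_antisymm (Nat.sInf_le hn) ?_
  by_contra hlt
  exact Nat.sInf_mem (s := Sᶜ) ⟨n, hn⟩ (h _ (not_le.1 hlt))

theorem grundyValue_eq_of {V α : Type*} [Finite V] {G : SimpleGraph V} {c : V → α} {n : ℕ}
    (hn : ∀ c', IsOption G c c' → grundyValue G c' ≠ n)
    (h : ∀ m < n, ∃ c', IsOption G c c' ∧ grundyValue G c' = m) : grundyValue G c = n := by
  rw [grundyValue]
  refine mex_eq_of ?_ ?_
  · rintro ⟨⟨c', hc'⟩, h'⟩
    exact hn c' hc' h'
  · intro m hm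
    obtain ⟨c', hc', h'⟩ := h m hm
    exact ⟨⟨c', hc'⟩, h'⟩

/-! ### Contractions of graphs -/

/-- `f` contracts pairwise disjoint connected vertex sets of `G`, its fibres, and the resulting
simple graph is `H`. -/
structure IsContraction {V W : Type*} (G : SimpleGraph V) (H : SimpleGraph W) (f : V → W) :
    Prop where
  surjective : Function.Surjective f
  connected : ∀ x y, f x = f y → Relation.ReflTransGen (fun a b => G.Adj a b ∧ f a = f b) x y
  map_adj : ∀ x y, G.Adj x y → f x ≠ f y → H.Adj (f x) (f y)
  lift_adj : ∀ a b, H.Adj a b → ∃ x y, G.Adj x y ∧ f x = a ∧ f y = b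

/-- A path in `G` projects to `H`. Conversely, each edge of a path in `H` lifts, and consecutive
lifts are linked inside the connected fibres, on which `d ∘ f` is constant. -/
theorem IsContraction.mem_colorRegion_iff {V W α : Type*} {G : SimpleGraph V} {H : SimpleGraph W}
    {f : V → W} (hf : IsContraction G H f) (d : W → α) (x y : V) :
    y ∈ colorRegion G (d ∘ f) x ↔ f y ∈ colorRegion H d (f x) := by
  constructor
  · intro h
    induction h with
    | refl => exact Relation.ReflTransGen.refl
    | @tail a b _ hab ih =>
      by_cases hne : f a = f b
      · rwa [← hne]
      · exact Relation.ReflTransGen.tail ih ⟨hf.map_adj a b hab.1 hne, hab.2⟩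
  · have hfib : ∀ a b, f a = f b → a ∈ colorRegion G (d ∘ f) x → b ∈ colorRegion G (d ∘ f) x :=
      fun a b hab ha => Relation.ReflTransGen.trans ha
        ((hf.connected a b hab).lift id fun _ _ h => ⟨h.1, congrArg d h.2⟩)
    -- The claim is made for the whole fibre over `w`, because a lifted edge may start or end at any
    -- point of a fibre.
    suffices h : ∀ w, w ∈ colorRegion H d (f x) → ∀ y, f y = w → y ∈ colorRegion G (d ∘ f) x from
      fun hy => h _ hy y rfl
    intro w hw
    induction hw with
    | refl => exact fun y hy => hfib x y hy.symm Relation.ReflTransGen.refl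
    | tail _ hab ih =>
      intro y hy
      obtain ⟨a, b, hadj, rfl, rfl⟩ := hf.lift_adj _ _ hab.1
      exact hfib b y hy.symm (Relation.ReflTransGen.tail (ih a rfl) ⟨hadj, hab.2⟩)

theorem IsContraction.recolor_comp {V W α : Type*} {G : SimpleGraph V} {H : SimpleGraph W}
    {f : V → W} (hf : IsContraction G H f) (d : W → α) (x : V) (γ : α) :
    recolor G (d ∘ f) x γ = recolor H d (f x) γ ∘ f := by
  funext y
  have h := hf.mem_colorRegion_iff d x y
  by_cases hy : f y ∈ colorRegion H d (f x)
  · simp only [recolor, Function.comp_apply, if_pos hy, if_pos (h.2 hy)]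
  · simp only [recolor, Function.comp_apply, if_neg hy, if_neg (mt h.1 hy)]

/-- Contracting monochromatic connected vertex sets does not change the value of a position. -/
theorem IsContraction.grundyValue_comp {V W α : Type*} [Finite V] [Finite W] {G : SimpleGraph V}
    {H : SimpleGraph W} {f : V → W} (hf : IsContraction G H f) (d : W → α) :
    grundyValue G (d ∘ f) = grundyValue H d := by
  -- Color regions of `d ∘ f` are preimages of color regions of `d`, so the options correspond;
  -- those of `d` have fewer two-colored edges in `H`.
  induction hn : (mixedEdges H d).ncard using Nat.strong_induction_on generalizing d with
  | _ n ih =>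
    subst hn
    rw [grundyValue, grundyValue]
    congr 1
    ext m
    constructor
    · rintro ⟨⟨_, v, w, hvw, hne, rfl⟩, rfl⟩
      have hopt : IsOption H d (recolor H d (f v) (d (f w))) :=
        ⟨f v, f w, hf.map_adj v w hvw fun h => hne (congrArg d h).symm, hne, rfl⟩
      refine ⟨⟨_, hopt⟩, ?_⟩
      simp only [hf.recolor_comp, Function.comp_apply]
      exact (ih _ hopt.ncard_mixedEdges_lt _ rfl).symm
    · rintro ⟨⟨_, a, b, hab, hne, rfl⟩, rfl⟩
      have hopt : IsOption H d (recolor H d a (d b)) := ⟨a, b, hab, hne, rfl⟩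
      obtain ⟨v, w, hvw, rfl, rfl⟩ := hf.lift_adj a b hab
      refine ⟨⟨recolor G (d ∘ f) v ((d ∘ f) w), v, w, hvw, hne, rfl⟩, ?_⟩
      simp only [hf.recolor_comp, Function.comp_apply]
      exact ih _ hopt.ncard_mixedEdges_lt _ rfl

open Classical in
theorem recolor_coloring {V α : Type*} {G : SimpleGraph V} (c : G.Coloring α) (v : V) (γ : α) :
    recolor G c v γ = fun x => if x = v then γ else c x := by
  have h : ∀ y, y ∈ colorRegion G c v ↔ y = v := by
    refine fun y => ⟨fun hy => ?_, fun hy => hy ▸ Relation.ReflTransGen.refl⟩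
    induction hy with
    | refl => rfl
    | tail _ hab _ => exact absurd hab.2 (c.valid hab.1)
  funext y
  simp only [recolor, h]

/-! ### Points of the route graph -/

section RouteGraph

variable {ι : Type*} {l l' : ι → ℕ}

@[simp] theorem routePoint_zero (l : ι → ℕ) (p : ι) : routePoint l p 0 = routeU l := by
  simp [routePoint]

theorem routeV_eq_routeU (h : ∃ p, l p = 0) : routeV l = routeU l := by
  simp only [routeV, dif_pos h]

theorem routeU_ne_routeV (h : ¬ ∃ p, l p = 0) : routeU l ≠ routeV l := by
  simp only [routeV, dif_neg h, routeU]
  simp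

@[simp] theorem routePoint_length (l : ι → ℕ) (p : ι) : routePoint l p (l p) = routeV l := by
  by_cases h : l p = 0
  · rw [routeV_eq_routeU ⟨p, h⟩, h, routePoint_zero]
  · simp [routePoint, h]

theorem routePoint_of_mem {p : ι} {s : ℕ} (h : s ∈ Set.Ioo 0 (l p)) :
    routePoint l p s = Sum.inr ⟨p, s, h⟩ := dif_pos h

theorem routePoint_eq_iff_of_mem {p q : ι} {s t : ℕ} (h : s ∈ Set.Ioo 0 (l p)) :
    routePoint l p s = routePoint l q t ↔ p = q ∧ s = t := by
  refine ⟨fun heq => ?_, fun ⟨hp, hs⟩ => by rw [hp, hs]⟩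
  rw [routePoint_of_mem h] at heq
  by_cases ht : t ∈ Set.Ioo 0 (l q)
  · rw [routePoint_of_mem ht] at heq
    have := Sum.inr.inj heq
    simp only [Sigma.mk.injEq] at this
    obtain ⟨rfl, h2⟩ := this
    exact ⟨rfl, congrArg Subtype.val (eq_of_heq h2)⟩
  · simp only [routePoint, dif_neg ht, routeU, routeV] at heq
    split_ifs at heq

theorem routePoint_eq_routeU_iff {p : ι} {s : ℕ} (h0 : ∀ q, l q ≠ 0) (hs : s ≤ l p) :
    routePoint l p s = routeU l ↔ s = 0 := by
  refine ⟨fun heq => ?_, fun h => by rw [h, routePoint_zero]⟩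
  by_contra hne
  by_cases h : s ∈ Set.Ioo 0 (l p)
  · rw [← routePoint_zero l p, routePoint_eq_iff_of_mem h] at heq
    exact hne heq.2
  · have : s = l p := by simp only [Set.mem_Ioo] at h; omega
    rw [this, routePoint_length] at heq
    exact routeU_ne_routeV (by simpa using h0) heq.symm

theorem routePoint_eq_routeV_iff {p : ι} {s : ℕ} (h0 : ∀ q, l q ≠ 0) (hs : s ≤ l p) :
    routePoint l p s = routeV l ↔ s = l p := by
  refine ⟨fun heq => ?_, fun h => by rw [h, routePoint_length]⟩
  by_contra hne
  by_cases h : s ∈ Set.Ioo 0 (l p)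
  · rw [← routePoint_length l p, routePoint_eq_iff_of_mem h] at heq
    exact hne heq.2
  · have : s = 0 := by simp only [Set.mem_Ioo] at h; omega
    rw [this, routePoint_zero] at heq
    exact routeU_ne_routeV (by simpa using h0) heq

theorem routePoint_eq_routeU_iff_of_merged {p : ι} {s : ℕ} (h0 : ∃ q, l q = 0) (hs : s ≤ l p) :
    routePoint l p s = routeU l ↔ s = 0 ∨ s = l p := by
  constructor
  · intro heq
    by_cases h : s ∈ Set.Ioo 0 (l p)
    · rw [← routePoint_zero l p, routePoint_eq_iff_of_mem h] at heq
      exact Or.inl heq.2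
    · simp only [Set.mem_Ioo] at h; omega
  · rintro (h | h)
    · rw [h, routePoint_zero]
    · rw [h, routePoint_length, routeV_eq_routeU h0]

theorem routeVertex_cases (x : RouteVertex l) :
    x = routeU l ∨ x = routeV l ∨ ∃ p s, s ∈ Set.Ioo 0 (l p) ∧ x = routePoint l p s := by
  rcases x with ⟨t, ht⟩ | ⟨p, s, hs⟩
  · cases t with
    | false => exact Or.inl rfl
    | true =>
      have h : ¬ ∃ p, l p = 0 := fun h => Bool.noConfusion (ht h)
      exact Or.inr (Or.inl (by simp only [routeV, dif_neg h]))
  · exact Or.inr (Or.inr ⟨p, s, hs, (routePoint_of_mem hs).symm⟩)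

theorem exists_eq_routePoint [Nonempty ι] (x : RouteVertex l) :
    ∃ p s, s ≤ l p ∧ x = routePoint l p s := by
  obtain ⟨q⟩ := ‹Nonempty ι›
  rcases routeVertex_cases x with rfl | rfl | ⟨p, s, hs, rfl⟩
  · exact ⟨q, 0, Nat.zero_le _, (routePoint_zero l q).symm⟩
  · exact ⟨q, l q, le_rfl, (routePoint_length l q).symm⟩
  · exact ⟨p, s, hs.2.le, rfl⟩

theorem routeGraph_adj_iff {x y : RouteVertex l} :
    (routeGraph l).Adj x y ↔ x ≠ y ∧ ∃ p s, s < l p ∧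
      (x = routePoint l p s ∧ y = routePoint l p (s + 1) ∨
        y = routePoint l p s ∧ x = routePoint l p (s + 1)) := by
  rw [routeGraph, SimpleGraph.fromRel_adj]
  refine and_congr_right fun _ => ⟨?_, ?_⟩
  · rintro (⟨p, s, hs, h⟩ | ⟨p, s, hs, h⟩)
    · exact ⟨p, s, hs, Or.inl h⟩
    · exact ⟨p, s, hs, Or.inr h⟩
  · rintro ⟨p, s, hs, h | h⟩
    · exact Or.inl ⟨p, s, hs, h⟩
    · exact Or.inr ⟨p, s, hs, h⟩

/-- Consecutive points could coincide only on a path of length 1 with merged ends, which the common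
parity excludes. -/
theorem routeGraph_adj_succ {r : ℕ} (hl : ∀ p, l p % 2 = r % 2) {p : ι} {s : ℕ} (hs : s < l p) :
    (routeGraph l).Adj (routePoint l p s) (routePoint l p (s + 1)) := by
  obtain ⟨d⟩ := nonempty_coloring_routeGraph l r hl
  refine routeGraph_adj_iff.2 ⟨fun heq => ?_, p, s, hs, Or.inl ⟨rfl, rfl⟩⟩
  by_cases h : s ∈ Set.Ioo 0 (l p)
  · exact absurd ((routePoint_eq_iff_of_mem h).1 heq).2 (by omega)
  by_cases h' : s + 1 ∈ Set.Ioo 0 (l p)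
  · exact absurd ((routePoint_eq_iff_of_mem h').1 heq.symm).2 (by omega)
  simp only [Set.mem_Ioo] at h h'
  have h1 : s + 1 = l p := by omega
  have h2 : s = 0 := by omega
  have := hl p
  refine routeU_ne_routeV (l := l) ?_ ?_
  · rintro ⟨q, hq⟩
    have := hl q
    omega
  · rw [h1, routePoint_length, h2, routePoint_zero] at heq
    exact heq

/-! ### Shortening the paths -/

/-- For each path `p`, the positions `0, …, l p` are mapped onto `0, …, l' p` by a weakly
increasing map with steps at most one. -/
structure IsShortening (l l' : ι → ℕ) (g : ι → ℕ → ℕ) : Prop where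
  zero : ∀ p, g p 0 = 0
  length : ∀ p, g p (l p) = l' p
  step : ∀ p s, s < l p → g p (s + 1) = g p s ∨ g p (s + 1) = g p s + 1

/-- The map of vertices given by maps of positions. -/
noncomputable def routeMap (l l' : ι → ℕ) (g : ι → ℕ → ℕ) : RouteVertex l → RouteVertex l' :=
  Sum.elim (fun t => if t.1 then routeV l' else routeU l') fun x => routePoint l' x.1 (g x.1 x.2)

namespace IsShortening

variable {g : ι → ℕ → ℕ}

theorem length_eq_zero (hg : IsShortening l l' g) {p : ι} (h : l p = 0) : l' p = 0 := by
  rw [← hg.length, h, hg.zero]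

theorem mono (hg : IsShortening l l' g) {p : ι} {s t : ℕ} (hst : s ≤ t) (ht : t ≤ l p) :
    g p s ≤ g p t := by
  induction t, hst using Nat.le_induction with
  | base => rfl
  | succ t _ ih =>
    have := ih (by omega)
    have := hg.step p t (by omega)
    omega

theorem le (hg : IsShortening l l' g) {p : ι} {s : ℕ} (hs : s ≤ l p) : g p s ≤ l' p :=
  hg.length p ▸ hg.mono hs le_rfl

theorem exists_step (hg : IsShortening l l' g) {p : ι} {t : ℕ} (ht : t < l' p) :
    ∃ s < l p, g p s = t ∧ g p (s + 1) = t + 1 := by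
  classical
  -- Discrete intermediate value: the first position with value above `t` comes right after one with
  -- value `t`.
  have hex : ∃ s, t < g p s := ⟨l p, by rwa [hg.length]⟩
  have h1 := Nat.find_spec hex
  have hle : Nat.find hex ≤ l p := Nat.find_min' hex (by rwa [hg.length])
  have hpos : Nat.find hex ≠ 0 := fun h => by rw [h, hg.zero] at h1; omega
  obtain ⟨s, hs⟩ := Nat.exists_eq_succ_of_ne_zero hpos
  have h2 := Nat.find_min hex (m := s) (by omega)
  rw [hs] at h1 hle
  rw [Nat.succ_eq_add_one] at h1 hle
  have := hg.step p s hle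
  exact ⟨s, hle, by omega, by omega⟩

theorem routeMap_routeU : routeMap l l' g (routeU l) = routeU l' := rfl

theorem routeMap_routeV (hg : IsShortening l l' g) : routeMap l l' g (routeV l) = routeV l' := by
  by_cases h : ∃ p, l p = 0
  · rw [routeV_eq_routeU h, routeV_eq_routeU (h.imp fun _ => hg.length_eq_zero)]
    rfl
  · simp only [routeV, dif_neg h, routeMap, Sum.elim_inl, if_true]

theorem routeMap_routePoint (hg : IsShortening l l' g) {p : ι} {s : ℕ} (hs : s ≤ l p) :
    routeMap l l' g (routePoint l p s) = routePoint l' p (g p s) := by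
  by_cases h : s ∈ Set.Ioo 0 (l p)
  · rw [routePoint_of_mem h]
    rfl
  · have : s = 0 ∨ s = l p := by simp only [Set.mem_Ioo] at h; omega
    rcases this with rfl | rfl
    · rw [hg.zero, routePoint_zero, routePoint_zero, routeMap_routeU]
    · rw [hg.length, routePoint_length, routePoint_length, hg.routeMap_routeV]

/-- Two vertices are joined within a fibre. -/
abbrev Joined (l l' : ι → ℕ) (g : ι → ℕ → ℕ) : RouteVertex l → RouteVertex l → Prop :=
  Relation.ReflTransGen fun a b => (routeGraph l).Adj a b ∧ routeMap l l' g a = routeMap l l' g b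

theorem joined_symm {x y : RouteVertex l} (h : Joined l l' g x y) : Joined l l' g y x :=
  by
  have : Std.Symm fun a b => (routeGraph l).Adj a b ∧ routeMap l l' g a = routeMap l l' g b :=
    ⟨fun _ _ h => ⟨h.1.symm, h.2.symm⟩⟩
  exact Relation.ReflTransGen.stdSymm.symm _ _ h

theorem routeMap_eq_of_joined {x y : RouteVertex l} (h : Joined l l' g x y) :
    routeMap l l' g x = routeMap l l' g y := by
  induction h with
  | refl => rfl
  | tail _ hab ih => exact ih.trans hab.2

theorem joined_routePoint (hg : IsShortening l l' g) {p : ι} {s t : ℕ} (hst : s ≤ t)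
    (ht : t ≤ l p) (h : g p s = g p t) :
    Joined l l' g (routePoint l p s) (routePoint l p t) := by
  induction t, hst using Nat.le_induction with
  | base => exact Relation.ReflTransGen.refl
  | succ t hst ih =>
    have h1 := hg.mono hst (by omega : t ≤ l p)
    have h2 := hg.mono (Nat.le_add_right t 1) ht
    have h3 : g p s = g p t := by omega
    refine (ih (by omega) h3).trans ?_
    by_cases heq : routePoint l p t = routePoint l p (t + 1)
    · rw [heq]
    · refine Relation.ReflTransGen.single
        ⟨routeGraph_adj_iff.2 ⟨heq, p, t, ht, Or.inl ⟨rfl, rfl⟩⟩, ?_⟩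
      rw [hg.routeMap_routePoint ht, hg.routeMap_routePoint (by omega : t ≤ l p), ← h3, h]

/-- The ends of the target coincide only if some path is shortened to length 0; that whole path then
lies in one fibre and links `u` to `v`. -/
theorem joined_routeU_routeV (hg : IsShortening l l' g) (h : routeU l' = routeV l') :
    Joined l l' g (routeU l) (routeV l) := by
  by_cases h0 : ∃ p, l' p = 0
  · obtain ⟨p, hp⟩ := h0
    rw [← routePoint_zero l p, ← routePoint_length l p]
    exact hg.joined_routePoint (Nat.zero_le _) le_rfl (by rw [hg.zero, hg.length, hp])
  · exact absurd h (routeU_ne_routeV h0)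

theorem joined_cases (hg : IsShortening l l' g) (x : RouteVertex l) :
    Joined l l' g x (routeU l) ∨ Joined l l' g x (routeV l) ∨
      ∃ p s, s ≤ l p ∧ g p s ∈ Set.Ioo 0 (l' p) ∧ x = routePoint l p s := by
  rcases routeVertex_cases x with rfl | rfl | ⟨p, s, hs, rfl⟩
  · exact Or.inl Relation.ReflTransGen.refl
  · exact Or.inr (Or.inl Relation.ReflTransGen.refl)
  · by_cases h0 : g p s = 0
    · left
      rw [← routePoint_zero l p]
      exact joined_symm (hg.joined_routePoint (Nat.zero_le _) hs.2.le (by rw [h0, hg.zero]))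
    · by_cases h1 : g p s = l' p
      · right; left
        rw [← routePoint_length l p]
        exact hg.joined_routePoint hs.2.le le_rfl (by rw [h1, hg.length])
      · have := hg.le hs.2.le
        exact Or.inr (Or.inr ⟨p, s, hs.2.le, ⟨by omega, by omega⟩, rfl⟩)

theorem isContraction (hg : IsShortening l l' g) :
    IsContraction (routeGraph l) (routeGraph l') (routeMap l l' g) where
  surjective w := by
    rcases routeVertex_cases w with rfl | rfl | ⟨p, t, ht, rfl⟩
    · exact ⟨_, routeMap_routeU⟩
    · exact ⟨_, hg.routeMap_routeV⟩
    · obtain ⟨s, hs, rfl, -⟩ := hg.exists_step ht.2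
      exact ⟨_, hg.routeMap_routePoint hs.le⟩
  connected x y hxy := by
    -- Fibres of different ends can meet only when the target ends are merged;
    -- `joined_routeU_routeV` covers this case.
    have huv (h : Joined l l' g x (routeU l)) (h' : Joined l l' g y (routeV l)) :
        Joined l l' g x y := by
      have hxy := ((routeMap_eq_of_joined h).symm.trans hxy).trans (routeMap_eq_of_joined h')
      rw [hg.routeMap_routeV, routeMap_routeU] at hxy
      exact (h.trans (hg.joined_routeU_routeV hxy)).trans (joined_symm h')
    have hvu (h : Joined l l' g x (routeV l)) (h' : Joined l l' g y (routeU l)) :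
        Joined l l' g x y := by
      have hxy := ((routeMap_eq_of_joined h).symm.trans hxy).trans (routeMap_eq_of_joined h')
      rw [hg.routeMap_routeV, routeMap_routeU] at hxy
      exact (h.trans (joined_symm (hg.joined_routeU_routeV hxy.symm))).trans
        (joined_symm h')
    have hu {p : ι} {s : ℕ} (h : g p s ∈ Set.Ioo 0 (l' p)) : routePoint l' p (g p s) ≠ routeU l' :=
      fun heq => by
        rw [← routePoint_zero l' p, routePoint_eq_iff_of_mem h] at heq
        exact h.1.ne' heq.2
    have hv {p : ι} {s : ℕ} (h : g p s ∈ Set.Ioo 0 (l' p)) : routePoint l' p (g p s) ≠ routeV l' :=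
      fun heq => by
        rw [← routePoint_length l' p, routePoint_eq_iff_of_mem h] at heq
        exact h.2.ne heq.2
    rcases hg.joined_cases x with hx | hx | ⟨p, s, hs, hps, rfl⟩ <;>
    rcases hg.joined_cases y with hy | hy | ⟨q, t, ht, hqt, rfl⟩
    · exact hx.trans (joined_symm hy)
    · exact huv hx hy
    · rw [routeMap_eq_of_joined hx, hg.routeMap_routePoint ht] at hxy
      exact absurd hxy.symm (hu hqt)
    · exact hvu hx hy
    · exact hx.trans (joined_symm hy)
    · rw [routeMap_eq_of_joined hx, hg.routeMap_routeV, hg.routeMap_routePoint ht] at hxy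
      exact absurd hxy.symm (hv hqt)
    · rw [routeMap_eq_of_joined hy, hg.routeMap_routePoint hs] at hxy
      exact absurd hxy (hu hps)
    · rw [routeMap_eq_of_joined hy, hg.routeMap_routeV, hg.routeMap_routePoint hs] at hxy
      exact absurd hxy (hv hps)
    · rw [hg.routeMap_routePoint hs, hg.routeMap_routePoint ht, routePoint_eq_iff_of_mem hps] at hxy
      obtain ⟨rfl, h⟩ := hxy
      rcases le_total s t with hst | hst
      · exact hg.joined_routePoint hst ht h
      · exact joined_symm (hg.joined_routePoint hst hs h.symm)
  map_adj x y hxy hne := by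
    obtain ⟨-, p, s, hs, h⟩ := routeGraph_adj_iff.1 hxy
    refine routeGraph_adj_iff.2 ⟨hne, p, g p s, ?_⟩
    have h1 := hg.routeMap_routePoint hs.le
    have h2 := hg.routeMap_routePoint (show s + 1 ≤ l p from hs)
    have h3 := hg.le (show s + 1 ≤ l p from hs)
    rcases hg.step p s hs with h4 | h4
    · rcases h with ⟨rfl, rfl⟩ | ⟨rfl, rfl⟩
      · exact absurd (by rw [h1, h2, h4]) hne
      · exact absurd (by rw [h1, h2, h4]) hne
    · refine ⟨by omega, ?_⟩
      rw [← h4, ← h1, ← h2]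
      rcases h with ⟨rfl, rfl⟩ | ⟨rfl, rfl⟩
      · exact Or.inl ⟨rfl, rfl⟩
      · exact Or.inr ⟨rfl, rfl⟩
  lift_adj a b hab := by
    obtain ⟨hne, p, t, ht, h⟩ := routeGraph_adj_iff.1 hab
    obtain ⟨s, hs, h1, h2⟩ := hg.exists_step ht
    have h3 := hg.routeMap_routePoint hs.le
    have h4 := hg.routeMap_routePoint (show s + 1 ≤ l p from hs)
    rw [h1] at h3
    rw [h2] at h4
    have hne' : routePoint l p s ≠ routePoint l p (s + 1) := fun heq => by
      rw [heq, h4] at h3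
      rcases h with ⟨rfl, rfl⟩ | ⟨rfl, rfl⟩
      · exact hne h3.symm
      · exact hne h3
    have hadj := routeGraph_adj_iff.2 ⟨hne', p, s, hs, Or.inl ⟨rfl, rfl⟩⟩
    rcases h with ⟨rfl, rfl⟩ | ⟨rfl, rfl⟩
    · exact ⟨_, _, hadj, h3, h4⟩
    · exact ⟨_, _, hadj.symm, h4, h3⟩

end IsShortening

end RouteGraph

/-! ### The options of a proper coloring -/

section RouteMove

variable {ι : Type*} {l l' : ι → ℕ} {r r' : ℕ}

/-- Colors alternate along each path, so the color of `u` determines the coloring. -/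
theorem coloring_routePoint (hl : ∀ p, l p % 2 = r % 2) (c : (routeGraph l).Coloring Bool) {p : ι}
    {s : ℕ} (hs : s ≤ l p) :
    c (routePoint l p s) = (c (routeU l) ^^ decide (s % 2 = 1)) := by
  induction s with
  | zero => simp
  | succ s ih =>
    have h1 := c.valid (routeGraph_adj_succ hl hs)
    rw [ih (by omega)] at h1
    rcases Nat.mod_two_eq_zero_or_one s with h | h
    · have h' : (s + 1) % 2 = 1 := by omega
      simp only [h, h'] at h1 ⊢
      revert h1
      cases c (routeU l) <;> cases c (routePoint l p (s + 1)) <;> decide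
    · have h' : (s + 1) % 2 = 0 := by omega
      simp only [h, h'] at h1 ⊢
      revert h1
      cases c (routeU l) <;> cases c (routePoint l p (s + 1)) <;> decide

theorem exists_coloring_routeU_eq (hl : ∀ p, l p % 2 = r % 2) (b : Bool) :
    ∃ d : (routeGraph l).Coloring Bool, d (routeU l) = b := by
  obtain ⟨d⟩ := nonempty_coloring_routeGraph l r hl
  by_cases h : d (routeU l) = b
  · exact ⟨d, h⟩
  · refine ⟨SimpleGraph.Coloring.mk (fun x => !d x) fun {x y} hxy heq => d.valid hxy ?_, ?_⟩
    · simpa using heq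
    · revert h
      change _ → (!d (routeU l)) = b
      cases d (routeU l) <;> cases b <;> decide

/-- A move at the vertex `m` of a properly colored route graph has the same value as a proper
coloring of the route graph obtained by a shortening which agrees with the move on parities. -/
theorem IsShortening.exists_grundyValue_recolor [Finite ι] [Nonempty ι] {g : ι → ℕ → ℕ}
    (hg : IsShortening l l' g) (hl : ∀ p, l p % 2 = r % 2) (hl' : ∀ p, l' p % 2 = r' % 2)
    (c : (routeGraph l).Coloring Bool) {m : RouteVertex l} {γ : Bool} (hγ : γ ≠ c m) (e : ℕ)
    (h : ∀ p s, s ≤ l p → routePoint l p s = m ∧ (s + 1 + g p s + e) % 2 = 0 ∨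
      routePoint l p s ≠ m ∧ (s + g p s + e) % 2 = 0) :
    ∃ d : (routeGraph l').Coloring Bool,
      grundyValue (routeGraph l) (recolor (routeGraph l) c m γ) = grundyValue (routeGraph l') d := by
  -- The parity of `e` records whether the move changes the color at `u`. Both colorings are then
  -- determined by parities of positions, and `h` says that these agree.
  obtain ⟨d, hd⟩ := exists_coloring_routeU_eq hl' (c (routeU l) ^^ decide (e % 2 = 1))
  refine ⟨d, ?_⟩
  rw [← hg.isContraction.grundyValue_comp, recolor_coloring]
  congr 1
  funext x
  obtain ⟨p, s, hs, rfl⟩ := exists_eq_routePoint x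
  rw [Function.comp_apply, hg.routeMap_routePoint hs, coloring_routePoint hl' d (hg.le hs), hd]
  have hγ' : γ = !c m := by
    revert hγ
    cases γ <;> cases c m <;> decide
  rcases h p s hs with ⟨hm, h1⟩ | ⟨hm, h1⟩
  · rw [if_pos hm, hγ', ← hm, coloring_routePoint hl c hs]
    rcases Nat.mod_two_eq_zero_or_one s with h2 | h2 <;>
    rcases Nat.mod_two_eq_zero_or_one e with h3 | h3 <;>
    rcases Nat.mod_two_eq_zero_or_one (g p s) with h4 | h4 <;>
    first
      | omega
      | (rw [h2, h3, h4]; cases c (routeU l) <;> decide)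
  · rw [if_neg hm, coloring_routePoint hl c hs]
    rcases Nat.mod_two_eq_zero_or_one s with h2 | h2 <;>
    rcases Nat.mod_two_eq_zero_or_one e with h3 | h3 <;>
    rcases Nat.mod_two_eq_zero_or_one (g p s) with h4 | h4 <;>
    first
      | omega
      | (rw [h2, h3, h4]; cases c (routeU l) <;> decide)

open Classical in
/-- The family of path lengths after the path `p` is shortened by two. -/
noncomputable def shortenPath (l : ι → ℕ) (p q : ι) : ℕ := if q = p then l p - 2 else l q

/-- The effect of a move on the family of path lengths: a move at an interior vertex shortens its
path by two, and a move at an end vertex shortens all paths by one or, if the ends are merged, all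
nontrivial paths by two. -/
inductive RouteMove (l : ι → ℕ) : (ι → ℕ) → Prop
  | interior (p : ι) (h : 2 ≤ l p) : RouteMove l (shortenPath l p)
  | merged (h0 : ∃ p, l p = 0) (h : ∃ p, l p ≠ 0) : RouteMove l fun p => l p - 2
  | unmerged [Nonempty ι] (h0 : ∀ p, l p ≠ 0) : RouteMove l fun p => l p - 1

theorem RouteMove.mod_two (h : RouteMove l l') (hl : ∀ p, l p % 2 = r % 2) :
    ∃ r', ∀ p, l' p % 2 = r' % 2 := by
  cases h with
  | interior p h =>
    refine ⟨r, fun q => ?_⟩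
    have h1 := hl p
    have h2 := hl q
    unfold shortenPath
    split_ifs <;> omega
  | merged h0 h =>
    obtain ⟨p, hp⟩ := h0
    refine ⟨0, fun q => ?_⟩
    have h1 := hl p
    have h2 := hl q
    dsimp only
    omega
  | unmerged h0 =>
    refine ⟨r + 1, fun q => ?_⟩
    have h1 := hl q
    have h2 := h0 q
    dsimp only
    omega

variable [Finite ι]

open Classical in
theorem exists_grundyValue_recolor_interior (hl : ∀ p, l p % 2 = r % 2)
    (c : (routeGraph l).Coloring Bool) {γ : Bool} {p : ι} {s : ℕ} (hs : s ∈ Set.Ioo 0 (l p))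
    (hγ : γ ≠ c (routePoint l p s)) :
    ∃ d : (routeGraph (shortenPath l p)).Coloring Bool,
      grundyValue (routeGraph l) (recolor (routeGraph l) c (routePoint l p s) γ) =
        grundyValue (routeGraph (shortenPath l p)) d := by
  have : Nonempty ι := ⟨p⟩
  obtain ⟨hs0, hs1⟩ := hs
  obtain ⟨r', hl'⟩ := (RouteMove.interior p (by omega : 2 ≤ l p)).mod_two hl
  -- The positions `s - 1`, `s`, `s + 1` of the path `p` all go to `s - 1`.
  have hg : IsShortening l (shortenPath l p)
      fun q t => if q = p then if t < s then t else if t = s then t - 1 else t - 2 else t := by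
    refine ⟨fun q => ?_, fun q => ?_, fun q t ht => ?_⟩
    · split_ifs <;> omega
    · unfold shortenPath
      by_cases hq : q = p
      · subst hq
        simp only [if_true]
        split_ifs <;> omega
      · simp only [if_neg hq]
    · split_ifs <;> omega
  refine hg.exists_grundyValue_recolor hl hl' c hγ 0 fun q t ht => ?_
  have hiff := routePoint_eq_iff_of_mem (p := p) (q := q) (t := t) ⟨hs0, hs1⟩
  by_cases hm : q = p ∧ t = s
  · refine Or.inl ⟨(hiff.2 ⟨hm.1.symm, hm.2.symm⟩).symm, ?_⟩
    simp only [hm, if_true, lt_irrefl, if_false]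
    omega
  · refine Or.inr ⟨fun h => hm ?_, ?_⟩
    · obtain ⟨h1, h2⟩ := hiff.1 h.symm
      exact ⟨h1.symm, h2.symm⟩
    · split_ifs with h1 h2 h3
      · omega
      · exact absurd ⟨h1, h3⟩ hm
      · omega
      · omega

theorem exists_grundyValue_recolor_merged [Nonempty ι] (hl : ∀ p, l p % 2 = r % 2)
    (c : (routeGraph l).Coloring Bool) {γ : Bool} (h0 : ∃ p, l p = 0) (hγ : γ ≠ c (routeU l)) :
    ∃ d : (routeGraph fun q => l q - 2).Coloring Bool,
      grundyValue (routeGraph l) (recolor (routeGraph l) c (routeU l) γ) =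
        grundyValue (routeGraph fun q => l q - 2) d := by
  have hl0 : ∀ p, l p % 2 = 0 := fun p => by
    obtain ⟨q, hq⟩ := h0
    have h1 := hl p
    have h2 := hl q
    omega
  have hl' : ∀ p, (l p - 2) % 2 = 0 % 2 := fun p => by
    have := hl0 p
    omega
  -- The positions 0 and 1 collapse at one end and `l q - 1` and `l q` at the other; trivial paths
  -- stay trivial.
  have hg : IsShortening l (fun q => l q - 2) fun q t => min (t - 1) (l q - 2) := by
    refine ⟨fun q => ?_, fun q => ?_, fun q t ht => ?_⟩ <;> omega
  refine hg.exists_grundyValue_recolor hl hl' c hγ 1 fun q t ht => ?_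
  rw [ne_eq, routePoint_eq_routeU_iff_of_merged h0 ht]
  have := hl0 q
  omega

theorem exists_grundyValue_recolor_routeU [Nonempty ι] (hl : ∀ p, l p % 2 = r % 2)
    (c : (routeGraph l).Coloring Bool) {γ : Bool} (h0 : ∀ p, l p ≠ 0) (hγ : γ ≠ c (routeU l)) :
    ∃ d : (routeGraph fun q => l q - 1).Coloring Bool,
      grundyValue (routeGraph l) (recolor (routeGraph l) c (routeU l) γ) =
        grundyValue (routeGraph fun q => l q - 1) d := by
  obtain ⟨r', hl'⟩ := (RouteMove.unmerged h0).mod_two hl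
  have hg : IsShortening l (fun q => l q - 1) fun _ t => t - 1 := by
    refine ⟨fun q => ?_, fun q => ?_, fun q t ht => ?_⟩ <;> omega
  refine hg.exists_grundyValue_recolor hl hl' c hγ 1 fun q t ht => ?_
  rw [ne_eq, routePoint_eq_routeU_iff h0 ht]
  omega

/-- By symmetry a move at `v` leads to the same lengths as one at `u`. Here `u` keeps its color,
hence the offset 0 instead of 1. -/
theorem exists_grundyValue_recolor_routeV [Nonempty ι] (hl : ∀ p, l p % 2 = r % 2)
    (c : (routeGraph l).Coloring Bool) {γ : Bool} (h0 : ∀ p, l p ≠ 0) (hγ : γ ≠ c (routeV l)) :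
    ∃ d : (routeGraph fun q => l q - 1).Coloring Bool,
      grundyValue (routeGraph l) (recolor (routeGraph l) c (routeV l) γ) =
        grundyValue (routeGraph fun q => l q - 1) d := by
  obtain ⟨r', hl'⟩ := (RouteMove.unmerged h0).mod_two hl
  have hg : IsShortening l (fun q => l q - 1) fun q t => min t (l q - 1) := by
    refine ⟨fun q => ?_, fun q => ?_, fun q t ht => ?_⟩ <;> omega
  refine hg.exists_grundyValue_recolor hl hl' c hγ 0 fun q t ht => ?_
  have := h0 q
  rw [ne_eq, routePoint_eq_routeV_iff h0 ht]
  omega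

theorem exists_routeMove_of_isOption (hl : ∀ p, l p % 2 = r % 2) (c : (routeGraph l).Coloring Bool)
    {c' : RouteVertex l → Bool} (h : IsOption (routeGraph l) c c') :
    ∃ l', RouteMove l l' ∧ ∃ d : (routeGraph l').Coloring Bool,
      grundyValue (routeGraph l) c' = grundyValue (routeGraph l') d := by
  obtain ⟨m, w, hmw, hne, rfl⟩ := h
  obtain ⟨-, p, t, ht, -⟩ := routeGraph_adj_iff.1 hmw
  have : Nonempty ι := ⟨p⟩
  by_cases h0 : ∃ q, l q = 0
  · have hmerged := RouteMove.merged h0 ⟨p, by omega⟩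
    rcases routeVertex_cases m with rfl | rfl | ⟨q, s, hs, rfl⟩
    · exact ⟨_, hmerged, exists_grundyValue_recolor_merged hl c h0 hne⟩
    · rw [routeV_eq_routeU h0] at hne ⊢
      exact ⟨_, hmerged, exists_grundyValue_recolor_merged hl c h0 hne⟩
    · exact ⟨_, .interior q (by have := hs.1; have := hs.2; omega),
        exists_grundyValue_recolor_interior hl c hs hne⟩
  · have h0' : ∀ q, l q ≠ 0 := by simpa using h0
    rcases routeVertex_cases m with rfl | rfl | ⟨q, s, hs, rfl⟩
    · exact ⟨_, .unmerged h0', exists_grundyValue_recolor_routeU hl c h0' hne⟩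
    · exact ⟨_, .unmerged h0', exists_grundyValue_recolor_routeV hl c h0' hne⟩
    · exact ⟨_, .interior q (by have := hs.1; have := hs.2; omega),
        exists_grundyValue_recolor_interior hl c hs hne⟩

theorem RouteMove.exists_isOption (h : RouteMove l l') (hl : ∀ p, l p % 2 = r % 2)
    (c : (routeGraph l).Coloring Bool) :
    ∃ c', IsOption (routeGraph l) c c' ∧ ∃ d : (routeGraph l').Coloring Bool,
      grundyValue (routeGraph l) c' = grundyValue (routeGraph l') d := by
  have hU (p : ι) (hp : l p ≠ 0) :
      (routeGraph l).Adj (routeU l) (routePoint l p 1) := by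
    have := routeGraph_adj_succ hl (p := p) (s := 0) (by omega)
    rwa [routePoint_zero] at this
  cases h with
  | interior p h =>
    -- All interior vertices of a path have the same effect; position 1 serves.
    have hadj := routeGraph_adj_succ hl (p := p) (s := 1) (by omega)
    have hne := (c.valid hadj).symm
    exact ⟨_, ⟨_, _, hadj, hne, rfl⟩,
      exists_grundyValue_recolor_interior hl c ⟨by omega, by omega⟩ hne⟩
  | merged h0 h =>
    obtain ⟨p, hp⟩ := h
    have : Nonempty ι := ⟨p⟩
    have hne := (c.valid (hU p hp)).symm
    exact ⟨_, ⟨_, _, hU p hp, hne, rfl⟩, exists_grundyValue_recolor_merged hl c h0 hne⟩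
  | unmerged h0 =>
    obtain ⟨p⟩ := ‹Nonempty ι›
    have : Nonempty ι := ⟨p⟩
    have hne := (c.valid (hU p (h0 p))).symm
    exact ⟨_, ⟨_, _, hU p (h0 p), hne, rfl⟩, exists_grundyValue_recolor_routeU hl c h0 hne⟩

end RouteMove

/-! ### The abstract game on the numbers of paths -/

/-- The families of path lengths which occur in the game, up to the number of paths of the
smallest length: `merged i j k` is `0^{1+} 2^i 4^j 6^k`, `adjacent i j` is `1^{1+} 3^i 5^j`,
`even i j k` is `2^i 4^j 6^k` and `odd i j` is `3^i 5^j`. -/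
inductive RouteState : Type
  | merged (i j k : ℕ)
  | adjacent (i j : ℕ)
  | even (i j k : ℕ)
  | odd (i j : ℕ)

namespace RouteState

/-- The families of path lengths which can be reached by one move. -/
def options : RouteState → List RouteState
  | merged i j k =>
    (if i = 0 then [] else [merged (i - 1) j k]) ++
      (if j = 0 then [] else [merged (i + 1) (j - 1) k])
      ++ (if k = 0 then [] else [merged i (j + 1) (k - 1)])
      ++ (if i = 0 ∧ j = 0 ∧ k = 0 then [] else [merged j k 0])
  | adjacent i j =>
    (if i = 0 then [] else [adjacent (i - 1) j]) ++
      (if j = 0 then [] else [adjacent (i + 1) (j - 1)])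
      ++ [merged i j 0]
  | even i j k =>
    (if i = 0 then [] else [merged (i - 1) j k, adjacent j k])
      ++ (if j = 0 then [] else [even (i + 1) (j - 1) k])
      ++ (if k = 0 then [] else [even i (j + 1) (k - 1)])
      ++ (if i = 0 ∧ (j ≠ 0 ∨ k ≠ 0) then [odd j k] else [])
  | odd i j =>
    (if i = 0 then [] else [adjacent (i - 1) j]) ++ (if j = 0 then [] else [odd (i + 1) (j - 1)])
      ++ (if i = 0 ∧ j = 0 then [] else [even i j 0])

/-- Values for `0^{1+} 2^i 4^j`. -/
def tableMerged0 : Matrix (Fin 6) (Fin 6) ℕ :=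
  !![0, 0, 0, 0, 0, 0;
     1, 3, 1, 2, 1, 2;
     2, 0, 0, 0, 0, 0;
     1, 3, 1, 2, 1, 2;
     2, 0, 0, 0, 0, 0;
     1, 3, 1, 2, 1, 2]

/-- The tables for `0^{1+} 2^i 4^j 6^k`, by the label of `k`. -/
def mergedTable : Fin 6 → Matrix (Fin 6) (Fin 6) ℕ :=
  ![tableMerged0, tableMerged1, tableMerged2, tableMerged3, tableMerged3, tableMerged3]

/-- The tables for `2^i 4^j 6^k`, by the label of `k`. -/
def evenTable : Fin 6 → Matrix (Fin 6) (Fin 6) ℕ :=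
  ![tableEven0, tableEven1, tableEven2, tableEven3, tableEven3, tableEven3]

/-- The label which follows a given label of rows and columns. -/
def nextLabel : Fin 6 → Fin 6 := ![1, 2, 3, 4, 5, 4]

/-- Under successor the labels form a finite automaton ending in a 2-cycle, which makes the mex
condition decidable over labels. -/
theorem tableIndex_succ (n : ℕ) : tableIndex (n + 1) = nextLabel (tableIndex n) := by
  match n with
  | 0 | 1 | 2 | 3 => rfl
  | n + 4 => by_cases h : Even n <;> simp [tableIndex, nextLabel, h, parity_simps]

/-- The value of the position for a family of path lengths. -/
def nimber : RouteState → ℕ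
  | merged i j k => tableEntry (mergedTable (tableIndex k)) i j
  | adjacent i j => tableEntry tableAdjacent i j
  | even i j k => tableEntry (evenTable (tableIndex k)) i j
  | odd i j => tableEntry tableOdd i j

/-- Whether `n` is the least natural number which is not in `L`. -/
def isMex (n : ℕ) (L : List ℕ) : Bool := !L.contains n && (List.range n).all L.contains

theorem isMex_nimber (S : RouteState) : isMex S.nimber (S.options.map nimber) = true := by
  -- Once the counts are split into zero and successor, all entries depend only on the labels of the
  -- predecessors, and each case is decided by running through them.
  have z : tableIndex 0 = 0 := rfl
  rcases S with ⟨i, j, k⟩ | ⟨i, j⟩ | ⟨i, j, k⟩ | ⟨i, j⟩ <;> rcases i with - | i <;>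
    rcases j with - | j <;> (try rcases k with - | k) <;>
    simp only [options, nimber, tableEntry, tableIndex_succ, z, List.map_append, List.map_cons,
      List.map_nil, Nat.add_sub_cancel, Nat.add_one_ne_zero, if_true, if_false, and_true,
      and_false, zero_add, ne_eq, not_true_eq_false, not_false_eq_true, or_true,
      or_false] <;>
    (try generalize tableIndex i = x) <;> (try generalize tableIndex j = y) <;>
    (try generalize tableIndex k = w) <;> decide +kernel +revert

theorem nimber_ne_of_mem_options {S T : RouteState} (h : T ∈ S.options) :
    T.nimber ≠ S.nimber := by
  have := S.isMex_nimber
  simp only [isMex, Bool.and_eq_true, Bool.not_eq_true', List.contains_eq_mem,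
    decide_eq_false_iff_not, List.mem_map, not_exists, not_and] at this
  exact this.1 T h

theorem exists_mem_options_nimber_eq {S : RouteState} {m : ℕ} (h : m < S.nimber) :
    ∃ T ∈ S.options, T.nimber = m := by
  have := S.isMex_nimber
  simp only [isMex, Bool.and_eq_true, List.contains_eq_mem, List.all_eq_true, List.mem_range,
    decide_eq_true_eq, List.mem_map] at this
  exact this.2 m h

end RouteState

/-! ### Families of path lengths and their states -/

section HasState

variable {ι : Type*} {l l' : ι → ℕ} {p : ι} {i j k : ℕ}

theorem exists_eq_of_routeCount_ne_zero {m : ℕ} (h : routeCount l m ≠ 0) : ∃ p, l p = m := by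
  by_contra hne
  have : IsEmpty {p // l p = m} := ⟨fun p => hne ⟨p.1, p.2⟩⟩
  exact h Nat.card_of_isEmpty

theorem routeCount_ne_zero [Finite ι] {m : ℕ} (h : l p = m) : routeCount l m ≠ 0 := by
  have : Nonempty {p // l p = m} := ⟨⟨p, h⟩⟩
  exact Nat.card_pos.ne'

theorem routeCount_congr {m n : ℕ} (h : ∀ p, l' p = n ↔ l p = m) :
    routeCount l' n = routeCount l m :=
  Nat.card_congr (Equiv.subtypeEquivRight h)

-- The two families differ only at `p`. The additive form avoids truncated subtraction.
open Classical in
theorem routeCount_shortenPath [Finite ι] (l : ι → ℕ) (p : ι) (n : ℕ) :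
    routeCount (shortenPath l p) n + (if l p = n then 1 else 0) =
      routeCount l n + (if l p - 2 = n then 1 else 0) := by
  have := Fintype.ofFinite ι
  have hcount (f : ι → ℕ) : routeCount f n =
      (∑ q ∈ Finset.univ.erase p, if f q = n then 1 else 0) + if f p = n then 1 else 0 := by
    rw [Finset.sum_erase_add _ _ (Finset.mem_univ p), routeCount, Nat.card_eq_fintype_card,
      Fintype.card_subtype, Finset.card_filter]
  rw [hcount, hcount, Finset.sum_congr rfl fun q hq => by
    rw [shortenPath, if_neg (Finset.ne_of_mem_erase hq)], shortenPath, if_pos rfl]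
  omega

open RouteState

/-- The family of path lengths `l` belongs to the state `S`. -/
def HasState (l : ι → ℕ) : RouteState → Prop
  | merged i j k => (∀ p, l p = 0 ∨ l p = 2 ∨ l p = 4 ∨ l p = 6) ∧ (∃ p, l p = 0) ∧
      routeCount l 2 = i ∧ routeCount l 4 = j ∧ routeCount l 6 = k
  | adjacent i j => (∀ p, l p = 1 ∨ l p = 3 ∨ l p = 5) ∧ (∃ p, l p = 1) ∧
      routeCount l 3 = i ∧ routeCount l 5 = j
  | even i j k => (∀ p, l p = 2 ∨ l p = 4 ∨ l p = 6) ∧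
      routeCount l 2 = i ∧ routeCount l 4 = j ∧ routeCount l 6 = k
  | odd i j => (∀ p, l p = 3 ∨ l p = 5) ∧ routeCount l 3 = i ∧ routeCount l 5 = j

namespace HasState

theorem exists_mod_two {S : RouteState} (h : HasState l S) : ∃ r, ∀ p, l p % 2 = r % 2 := by
  cases S with
  | merged i j k => exact ⟨0, fun p => by have := h.1 p; omega⟩
  | adjacent i j => exact ⟨1, fun p => by have := h.1 p; omega⟩
  | even i j k => exact ⟨0, fun p => by have := h.1 p; omega⟩
  | odd i j => exact ⟨1, fun p => by have := h.1 p; omega⟩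

/-! ### Effect of each move on the state -/

theorem merged_two [Finite ι] (h : HasState l (merged i j k)) (hp : l p = 2) :
    i ≠ 0 ∧ HasState (shortenPath l p) (merged (i - 1) j k) := by
  obtain ⟨hl, -, rfl, rfl, rfl⟩ := h
  have h2 := routeCount_shortenPath l p 2
  have h4 := routeCount_shortenPath l p 4
  have h6 := routeCount_shortenPath l p 6
  norm_num [hp] at h2 h4 h6
  refine ⟨by omega, fun q => ?_, ⟨p, by simp [shortenPath, hp]⟩, by omega, by omega, by omega⟩
  have := hl q
  unfold shortenPath
  split_ifs <;> omega

theorem merged_four [Finite ι] (h : HasState l (merged i j k)) (hp : l p = 4) :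
    j ≠ 0 ∧ HasState (shortenPath l p) (merged (i + 1) (j - 1) k) := by
  obtain ⟨hl, ⟨q, hq⟩, rfl, rfl, rfl⟩ := h
  have h2 := routeCount_shortenPath l p 2
  have h4 := routeCount_shortenPath l p 4
  have h6 := routeCount_shortenPath l p 6
  norm_num [hp] at h2 h4 h6
  refine ⟨by omega, fun q => ?_, ⟨q, ?_⟩, by omega, by omega, by omega⟩
  · have := hl q
    unfold shortenPath
    split_ifs <;> omega
  · rw [shortenPath, if_neg (by rintro rfl; omega), hq]

theorem merged_six [Finite ι] (h : HasState l (merged i j k)) (hp : l p = 6) :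
    k ≠ 0 ∧ HasState (shortenPath l p) (merged i (j + 1) (k - 1)) := by
  obtain ⟨hl, ⟨q, hq⟩, rfl, rfl, rfl⟩ := h
  have h2 := routeCount_shortenPath l p 2
  have h4 := routeCount_shortenPath l p 4
  have h6 := routeCount_shortenPath l p 6
  norm_num [hp] at h2 h4 h6
  refine ⟨by omega, fun q => ?_, ⟨q, ?_⟩, by omega, by omega, by omega⟩
  · have := hl q
    unfold shortenPath
    split_ifs <;> omega
  · rw [shortenPath, if_neg (by rintro rfl; omega), hq]

theorem merged_end (h : HasState l (merged i j k)) :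
    HasState (fun q => l q - 2) (merged j k 0) := by
  obtain ⟨hl, ⟨q, hq⟩, -, rfl, rfl⟩ := h
  refine ⟨fun q => ?_, ⟨q, by dsimp only; omega⟩, routeCount_congr fun p => ?_,
    routeCount_congr fun p => ?_, ?_⟩
  · have := hl q
    dsimp only
    omega
  · omega
  · omega
  -- Lengths were at most 6, so no path of length 6 remains.
  · by_contra hne
    obtain ⟨p, hp⟩ := exists_eq_of_routeCount_ne_zero hne
    have := hl p
    omega

theorem adjacent_three [Finite ι] (h : HasState l (adjacent i j)) (hp : l p = 3) :
    i ≠ 0 ∧ HasState (shortenPath l p) (adjacent (i - 1) j) := by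
  obtain ⟨hl, -, rfl, rfl⟩ := h
  have h3 := routeCount_shortenPath l p 3
  have h5 := routeCount_shortenPath l p 5
  norm_num [hp] at h3 h5
  refine ⟨by omega, fun q => ?_, ⟨p, by simp [shortenPath, hp]⟩, by omega, by omega⟩
  have := hl q
  unfold shortenPath
  split_ifs <;> omega

theorem adjacent_five [Finite ι] (h : HasState l (adjacent i j)) (hp : l p = 5) :
    j ≠ 0 ∧ HasState (shortenPath l p) (adjacent (i + 1) (j - 1)) := by
  obtain ⟨hl, ⟨q, hq⟩, rfl, rfl⟩ := h
  have h3 := routeCount_shortenPath l p 3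
  have h5 := routeCount_shortenPath l p 5
  norm_num [hp] at h3 h5
  refine ⟨by omega, fun q => ?_, ⟨q, ?_⟩, by omega, by omega⟩
  · have := hl q
    unfold shortenPath
    split_ifs <;> omega
  · rw [shortenPath, if_neg (by rintro rfl; omega), hq]

theorem adjacent_end (h : HasState l (adjacent i j)) :
    HasState (fun q => l q - 1) (merged i j 0) := by
  obtain ⟨hl, ⟨q, hq⟩, rfl, rfl⟩ := h
  refine ⟨fun q => ?_, ⟨q, by dsimp only; omega⟩, routeCount_congr fun p => ?_,
    routeCount_congr fun p => ?_, ?_⟩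
  · have := hl q
    dsimp only
    omega
  · omega
  · omega
  · by_contra hne
    obtain ⟨p, hp⟩ := exists_eq_of_routeCount_ne_zero hne
    have := hl p
    omega

/-- The chosen path gets length 0, which merges the two ends. -/
theorem even_two [Finite ι] (h : HasState l (even i j k)) (hp : l p = 2) :
    i ≠ 0 ∧ HasState (shortenPath l p) (merged (i - 1) j k) := by
  obtain ⟨hl, rfl, rfl, rfl⟩ := h
  have h2 := routeCount_shortenPath l p 2
  have h4 := routeCount_shortenPath l p 4
  have h6 := routeCount_shortenPath l p 6
  norm_num [hp] at h2 h4 h6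
  refine ⟨by omega, fun q => ?_, ⟨p, by simp [shortenPath, hp]⟩, by omega, by omega, by omega⟩
  have := hl q
  unfold shortenPath
  split_ifs <;> omega

theorem even_four [Finite ι] (h : HasState l (even i j k)) (hp : l p = 4) :
    j ≠ 0 ∧ HasState (shortenPath l p) (even (i + 1) (j - 1) k) := by
  obtain ⟨hl, rfl, rfl, rfl⟩ := h
  have h2 := routeCount_shortenPath l p 2
  have h4 := routeCount_shortenPath l p 4
  have h6 := routeCount_shortenPath l p 6
  norm_num [hp] at h2 h4 h6
  refine ⟨by omega, fun q => ?_, by omega, by omega, by omega⟩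
  have := hl q
  unfold shortenPath
  split_ifs <;> omega

theorem even_six [Finite ι] (h : HasState l (even i j k)) (hp : l p = 6) :
    k ≠ 0 ∧ HasState (shortenPath l p) (even i (j + 1) (k - 1)) := by
  obtain ⟨hl, rfl, rfl, rfl⟩ := h
  have h2 := routeCount_shortenPath l p 2
  have h4 := routeCount_shortenPath l p 4
  have h6 := routeCount_shortenPath l p 6
  norm_num [hp] at h2 h4 h6
  refine ⟨by omega, fun q => ?_, by omega, by omega, by omega⟩
  have := hl q
  unfold shortenPath
  split_ifs <;> omega

theorem even_end (h : HasState l (even i j k)) (hi : i ≠ 0) :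
    HasState (fun q => l q - 1) (adjacent j k) := by
  obtain ⟨hl, rfl, rfl, rfl⟩ := h
  obtain ⟨p, hp⟩ := exists_eq_of_routeCount_ne_zero hi
  refine ⟨fun q => ?_, ⟨p, by dsimp only; omega⟩, routeCount_congr fun p => ?_,
    routeCount_congr fun p => ?_⟩
  · have := hl q
    dsimp only
    omega
  · omega
  · omega

/-- Without a path of length 2, no path becomes an edge, so the ends stay nonadjacent. -/
theorem even_end_of_no_two [Finite ι] (h : HasState l (even 0 j k)) :
    HasState (fun q => l q - 1) (odd j k) := by
  obtain ⟨hl, h0, rfl, rfl⟩ := h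
  refine ⟨fun q => ?_, routeCount_congr fun p => ?_, routeCount_congr fun p => ?_⟩
  · have := hl q
    have : l q ≠ 2 := fun hq => routeCount_ne_zero hq h0
    dsimp only
    omega
  · omega
  · omega

theorem odd_three [Finite ι] (h : HasState l (odd i j)) (hp : l p = 3) :
    i ≠ 0 ∧ HasState (shortenPath l p) (adjacent (i - 1) j) := by
  obtain ⟨hl, rfl, rfl⟩ := h
  have h3 := routeCount_shortenPath l p 3
  have h5 := routeCount_shortenPath l p 5
  norm_num [hp] at h3 h5
  refine ⟨by omega, fun q => ?_, ⟨p, by simp [shortenPath, hp]⟩, by omega, by omega⟩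
  have := hl q
  unfold shortenPath
  split_ifs <;> omega

theorem odd_five [Finite ι] (h : HasState l (odd i j)) (hp : l p = 5) :
    j ≠ 0 ∧ HasState (shortenPath l p) (odd (i + 1) (j - 1)) := by
  obtain ⟨hl, rfl, rfl⟩ := h
  have h3 := routeCount_shortenPath l p 3
  have h5 := routeCount_shortenPath l p 5
  norm_num [hp] at h3 h5
  refine ⟨by omega, fun q => ?_, by omega, by omega⟩
  have := hl q
  unfold shortenPath
  split_ifs <;> omega

theorem odd_end (h : HasState l (odd i j)) : HasState (fun q => l q - 1) (even i j 0) := by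
  obtain ⟨hl, rfl, rfl⟩ := h
  refine ⟨fun q => ?_, routeCount_congr fun p => ?_, routeCount_congr fun p => ?_, ?_⟩
  · have := hl q
    dsimp only
    omega
  · omega
  · omega
  · by_contra hne
    obtain ⟨p, hp⟩ := exists_eq_of_routeCount_ne_zero hne
    have := hl p
    omega

/-! ### Moves of families and options of states -/

variable {S T : RouteState}

theorem exists_mem_options [Finite ι] (h : HasState l S) (hm : RouteMove l l') :
    ∃ T ∈ S.options, HasState l' T := by
  cases S with
  | merged i j k =>
    cases hm with
    | interior p hp =>
      rcases h.1 p with hp' | hp' | hp' | hp'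
      · omega
      · exact ⟨_, by simp [options, h.merged_two hp'], (h.merged_two hp').2⟩
      · exact ⟨_, by simp [options, h.merged_four hp'], (h.merged_four hp').2⟩
      · exact ⟨_, by simp [options, h.merged_six hp'], (h.merged_six hp').2⟩
    | merged h0 hne =>
      obtain ⟨p, hp⟩ := hne
      have hp' : ¬(i = 0 ∧ j = 0 ∧ k = 0) := by
        rcases h.1 p with hp' | hp' | hp' | hp'
        · omega
        · exact fun hz => (h.merged_two hp').1 hz.1
        · exact fun hz => (h.merged_four hp').1 hz.2.1
        · exact fun hz => (h.merged_six hp').1 hz.2.2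
      exact ⟨_, by simp only [options, if_neg hp']; simp, h.merged_end⟩
    | unmerged h0 =>
      obtain ⟨p, hp⟩ := h.2.1
      exact absurd hp (h0 p)
  | adjacent i j =>
    cases hm with
    | interior p hp =>
      rcases h.1 p with hp' | hp' | hp'
      · omega
      · exact ⟨_, by simp [options, h.adjacent_three hp'], (h.adjacent_three hp').2⟩
      · exact ⟨_, by simp [options, h.adjacent_five hp'], (h.adjacent_five hp').2⟩
    | merged h0 =>
      obtain ⟨p, hp⟩ := h0
      have := h.1 p
      omega
    | unmerged h0 => exact ⟨_, by simp [options], h.adjacent_end⟩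
  | even i j k =>
    cases hm with
    | interior p hp =>
      rcases h.1 p with hp' | hp' | hp'
      · exact ⟨_, by simp [options, h.even_two hp'], (h.even_two hp').2⟩
      · exact ⟨_, by simp [options, h.even_four hp'], (h.even_four hp').2⟩
      · exact ⟨_, by simp [options, h.even_six hp'], (h.even_six hp').2⟩
    | merged h0 =>
      obtain ⟨p, hp⟩ := h0
      have := h.1 p
      omega
    | unmerged h0 =>
      by_cases hi : i = 0
      · subst hi
        obtain ⟨p⟩ := ‹Nonempty ι›
        -- A move at an end needs at least one path: two isolated vertices have no options.
        have hp : j ≠ 0 ∨ k ≠ 0 := by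
          rcases h.1 p with hp' | hp' | hp'
          · exact absurd rfl (h.even_two hp').1
          · exact Or.inl (h.even_four hp').1
          · exact Or.inr (h.even_six hp').1
        exact ⟨_, by simp [options, hp], h.even_end_of_no_two⟩
      · exact ⟨_, by simp [options, hi], h.even_end hi⟩
  | odd i j =>
    cases hm with
    | interior p hp =>
      rcases h.1 p with hp' | hp'
      · exact ⟨_, by simp [options, h.odd_three hp'], (h.odd_three hp').2⟩
      · exact ⟨_, by simp [options, h.odd_five hp'], (h.odd_five hp').2⟩
    | merged h0 =>
      obtain ⟨p, hp⟩ := h0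
      have := h.1 p
      omega
    | unmerged h0 =>
      obtain ⟨p⟩ := ‹Nonempty ι›
      have hp : ¬(i = 0 ∧ j = 0) := by
        rcases h.1 p with hp' | hp'
        · exact fun hz => (h.odd_three hp').1 hz.1
        · exact fun hz => (h.odd_five hp').1 hz.2
      exact ⟨_, by simp only [options, if_neg hp]; simp, h.odd_end⟩

theorem exists_routeMove [Finite ι] (h : HasState l S) (hT : T ∈ S.options) :
    ∃ l', RouteMove l l' ∧ HasState l' T := by
  have hex {m n : ℕ} (hc : routeCount l m = n) (hn : n ≠ 0) : ∃ p, l p = m :=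
    exists_eq_of_routeCount_ne_zero (by rwa [hc])
  cases S with
  | merged i j k =>
    simp only [options, List.mem_append, List.mem_ite_nil_left, List.mem_singleton] at hT
    obtain ⟨-, h0, hi, hj, hk⟩ := id h
    rcases hT with ((⟨hne, rfl⟩ | ⟨hne, rfl⟩) | ⟨hne, rfl⟩) | ⟨hne, rfl⟩
    · obtain ⟨p, hp⟩ := hex hi hne
      exact ⟨_, .interior p (by omega), (h.merged_two hp).2⟩
    · obtain ⟨p, hp⟩ := hex hj hne
      exact ⟨_, .interior p (by omega), (h.merged_four hp).2⟩
    · obtain ⟨p, hp⟩ := hex hk hne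
      exact ⟨_, .interior p (by omega), (h.merged_six hp).2⟩
    · refine ⟨_, .merged h0 ?_, h.merged_end⟩
      by_cases hi' : i = 0
      · by_cases hj' : j = 0
        · exact (hex hk fun hk' => hne ⟨hi', hj', hk'⟩).imp fun p hp => by omega
        · exact (hex hj hj').imp fun p hp => by omega
      · exact (hex hi hi').imp fun p hp => by omega
  | adjacent i j =>
    simp only [options, List.mem_append, List.mem_ite_nil_left, List.mem_singleton] at hT
    obtain ⟨hl, ⟨q, -⟩, hi, hj⟩ := id h
    rcases hT with (⟨hne, rfl⟩ | ⟨hne, rfl⟩) | rfl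
    · obtain ⟨p, hp⟩ := hex hi hne
      exact ⟨_, .interior p (by omega), (h.adjacent_three hp).2⟩
    · obtain ⟨p, hp⟩ := hex hj hne
      exact ⟨_, .interior p (by omega), (h.adjacent_five hp).2⟩
    · have : Nonempty ι := ⟨q⟩
      exact ⟨_, .unmerged fun p => by have := hl p; omega, h.adjacent_end⟩
  | even i j k =>
    simp only [options, List.mem_append, List.mem_ite_nil_left, List.mem_ite_nil_right,
      List.mem_cons, List.not_mem_nil, or_false] at hT
    obtain ⟨hl, hi, hj, hk⟩ := id h
    have h0 : ∀ p, l p ≠ 0 := fun p => by have := hl p; omega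
    rcases hT with ((⟨hne, rfl | rfl⟩ | ⟨hne, rfl⟩) | ⟨hne, rfl⟩) | ⟨⟨rfl, hne⟩, rfl⟩
    · obtain ⟨p, hp⟩ := hex hi hne
      exact ⟨_, .interior p (by omega), (h.even_two hp).2⟩
    · obtain ⟨p, hp⟩ := hex hi hne
      have : Nonempty ι := ⟨p⟩
      exact ⟨_, .unmerged h0, h.even_end hne⟩
    · obtain ⟨p, hp⟩ := hex hj hne
      exact ⟨_, .interior p (by omega), (h.even_four hp).2⟩
    · obtain ⟨p, hp⟩ := hex hk hne
      exact ⟨_, .interior p (by omega), (h.even_six hp).2⟩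
    · have : Nonempty ι := hne.elim (fun hne => (hex hj hne).nonempty)
        fun hne => (hex hk hne).nonempty
      exact ⟨_, .unmerged h0, h.even_end_of_no_two⟩
  | odd i j =>
    simp only [options, List.mem_append, List.mem_ite_nil_left, List.mem_singleton] at hT
    obtain ⟨hl, hi, hj⟩ := id h
    rcases hT with (⟨hne, rfl⟩ | ⟨hne, rfl⟩) | ⟨hne, rfl⟩
    · obtain ⟨p, hp⟩ := hex hi hne
      exact ⟨_, .interior p (by omega), (h.odd_three hp).2⟩
    · obtain ⟨p, hp⟩ := hex hj hne
      exact ⟨_, .interior p (by omega), (h.odd_five hp).2⟩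
    · have : Nonempty ι := by
        by_cases hi' : i = 0
        · exact (hex hj fun hj' => hne ⟨hi', hj'⟩).nonempty
        · exact (hex hi hi').nonempty
      exact ⟨_, .unmerged fun p => by have := hl p; omega, h.odd_end⟩

end HasState

/-! ### Induction on the total length of the paths -/

theorem RouteMove.finsum_lt [Finite ι] (h : RouteMove l l') : ∑ᶠ p, l' p < ∑ᶠ p, l p := by
  have := Fintype.ofFinite ι
  rw [finsum_eq_sum_of_fintype, finsum_eq_sum_of_fintype]
  cases h with
  | interior p h =>
    refine Finset.sum_lt_sum (fun q _ => ?_) ⟨p, Finset.mem_univ p, ?_⟩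
    · unfold shortenPath
      split_ifs with hq
      · rw [hq]
        omega
      · rfl
    · rw [shortenPath, if_pos rfl]
      omega
  | merged h0 h =>
    obtain ⟨p, hp⟩ := h
    exact Finset.sum_lt_sum (fun q _ => Nat.sub_le _ _) ⟨p, Finset.mem_univ p, by omega⟩
  | unmerged h0 =>
    obtain ⟨p⟩ := ‹Nonempty ι›
    have := h0 p
    exact Finset.sum_lt_sum (fun q _ => Nat.sub_le _ _) ⟨p, Finset.mem_univ p, by omega⟩

/-- The value of a properly colored route graph is the value of its state. -/
theorem HasState.grundyValue_eq [Finite ι] {S : RouteState} (h : HasState l S)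
    (c : (routeGraph l).Coloring Bool) : grundyValue (routeGraph l) c = S.nimber := by
  induction hn : ∑ᶠ p, l p using Nat.strong_induction_on generalizing l S with
  | _ n ih =>
    subst hn
    obtain ⟨r, hl⟩ := h.exists_mod_two
    refine grundyValue_eq_of (fun c' hc' => ?_) fun m hm => ?_
    · obtain ⟨l', hmove, d, hd⟩ := exists_routeMove_of_isOption hl c hc'
      obtain ⟨T, hT, hT'⟩ := h.exists_mem_options hmove
      rw [hd, ih _ hmove.finsum_lt hT' d rfl]
      exact nimber_ne_of_mem_options hT
    · obtain ⟨T, hT, rfl⟩ := exists_mem_options_nimber_eq hm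
      obtain ⟨l', hmove, hT'⟩ := h.exists_routeMove hT
      obtain ⟨c', hc', d, hd⟩ := hmove.exists_isOption hl c
      exact ⟨c', hc', hd.trans (ih _ hmove.finsum_lt hT' d rfl)⟩

theorem IsEvenRoutes.hasState_merged {a : ℕ} (h : IsEvenRoutes l a i j k) (ha : 1 ≤ a) :
    HasState l (merged i j k) :=
  ⟨h.1, exists_eq_of_routeCount_ne_zero (by rw [h.2.1]; omega), h.2.2⟩

theorem IsEvenRoutes.hasState_even [Finite ι] (h : IsEvenRoutes l 0 i j k) : HasState l (even i j k) :=
  ⟨fun p => (h.1 p).resolve_left fun hp => routeCount_ne_zero hp h.2.1, h.2.2⟩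

theorem IsOddRoutes.hasState_adjacent {a : ℕ} (h : IsOddRoutes l a i j) (ha : 1 ≤ a) :
    HasState l (adjacent i j) :=
  ⟨h.1, exists_eq_of_routeCount_ne_zero (by rw [h.2.1]; omega), h.2.2⟩

theorem IsOddRoutes.hasState_odd [Finite ι] (h : IsOddRoutes l 0 i j) : HasState l (odd i j) :=
  ⟨fun p => (h.1 p).resolve_left fun hp => routeCount_ne_zero hp h.2.1, h.2.2⟩

end HasState

theorem RouteState.mergedTable_of_three_le {k : ℕ} (hk : 3 ≤ k) :
    mergedTable (tableIndex k) = tableMerged3 := by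
  obtain ⟨k, rfl⟩ := Nat.exists_eq_add_of_le' hk
  simp only [tableIndex_succ]
  generalize tableIndex k = x
  fin_cases x <;> rfl

theorem RouteState.evenTable_of_three_le {k : ℕ} (hk : 3 ≤ k) :
    evenTable (tableIndex k) = tableEven3 := by
  obtain ⟨k, rfl⟩ := Nat.exists_eq_add_of_le' hk
  simp only [tableIndex_succ]
  generalize tableIndex k = x
  fin_cases x <;> rfl

theorem mainTheorem2 {ι : Type*} [Finite ι] (l : ι → ℕ) (c : (routeGraph l).Coloring Bool)
    (i j : ℕ) :
    (∀ a, 1 ≤ a → IsEvenRoutes l a i j 1 →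
      grundyValue (routeGraph l) c = tableEntry tableMerged1 i j) ∧
    (∀ a, 1 ≤ a → IsEvenRoutes l a i j 2 →
      grundyValue (routeGraph l) c = tableEntry tableMerged2 i j) ∧
    (∀ a k, 1 ≤ a → 3 ≤ k → IsEvenRoutes l a i j k →
      grundyValue (routeGraph l) c = tableEntry tableMerged3 i j) ∧
    (∀ a, 1 ≤ a → IsOddRoutes l a i j →
      grundyValue (routeGraph l) c = tableEntry tableAdjacent i j) ∧
    (IsEvenRoutes l 0 i j 0 →
      grundyValue (routeGraph l) c = tableEntry tableEven0 i j) ∧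
    (IsEvenRoutes l 0 i j 1 →
      grundyValue (routeGraph l) c = tableEntry tableEven1 i j) ∧
    (IsEvenRoutes l 0 i j 2 →
      grundyValue (routeGraph l) c = tableEntry tableEven2 i j) ∧
    (∀ k, 3 ≤ k → IsEvenRoutes l 0 i j k →
      grundyValue (routeGraph l) c = tableEntry tableEven3 i j) ∧
    (IsOddRoutes l 0 i j →
      grundyValue (routeGraph l) c = tableEntry tableOdd i j) := by
  refine ⟨fun a ha h => (h.hasState_merged ha).grundyValue_eq c,
    fun a ha h => (h.hasState_merged ha).grundyValue_eq c, fun a k ha hk h => ?_,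
    fun a ha h => (h.hasState_adjacent ha).grundyValue_eq c,
    fun h => h.hasState_even.grundyValue_eq c, fun h => h.hasState_even.grundyValue_eq c,
    fun h => h.hasState_even.grundyValue_eq c, fun k hk h => ?_,
    fun h => h.hasState_odd.grundyValue_eq c⟩
  · rw [(h.hasState_merged ha).grundyValue_eq c, RouteState.nimber,
      RouteState.mergedTable_of_three_le hk]
  · rw [h.hasState_even.grundyValue_eq c, RouteState.nimber, RouteState.evenTable_of_three_le hk]
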